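/- Let $H_m=\sum_{j=1}^m \frac1j$ ($H_0=0$), and for $n\ge 0$ put $$q_n=\sum_{k=0}^n\binom nk^2k!,\qquad p_n=\sum_{k=0}^n\binom nk^2k!\,(2H_{n-k}-H_k),$$ and for $n\ge 1$ put $\Delta_n=n\,(p_{n-1}q_n-p_nq_{n-1})$. Then the $q_n$ are positive integers and Euler's constant $\gamma$ has the continued fraction expansion $$\gamma=\mathop{\mathbf K}_{n=1}^{\infty}\left(\frac{a_n^*}{b_n^*}\right)=\cfrac{1}{2-\cfrac{1}{4-\cfrac{5}{16+\cfrac{36}{59-\cfrac{15740}{404+\cdots}}}}}$$ where $$a_1^*=1,\quad a_2^*=-1,\quad a_3^*=-5,\quad a_4^*=36,\quad a_5^*=-15740,$$ $$b_1^*=2,\quad b_2^*=4,\quad b_3^*=16,\quad b_4^*=59,\quad b_5^*=404,$$ and for $n\ge 6$ $$a_n^*=-\frac{(n-1)^2}{4}\Delta_n\Delta_{n-2},\qquad b_n^*=n^2\Delta_{n-1}+\frac{(n-1)(n-2)}{2}q_{n-2}.$$ That is, $a_n^*\ne0$ for all $n\ge1$, and if $A_{-1}=1$, $A_0=0$, $B_{-1}=0$,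 $B_0=1$, $A_n=b_n^*A_{n-1}+a_n^*A_{n-2}$ and $B_n=b_n^*B_{n-1}+a_n^*B_{n-2}$ for $n\ge1$, then $B_n\ne0$ for all $n\ge 0$ and $A_n/B_n\to\gamma$ as $n\to\infty$. Moreover, the $\Delta_n$ ($n\ge1$) are integers, and $(\Delta_n)_{n\ge1}$ is the unique sequence of rational numbers with initial values $\Delta_1=-1$, $\Delta_2=-2$, $\Delta_3=-5$, $\Delta_4=8$ that satisfies, for all $n\ge3$, the third-order linear recurrence $$(n-1)(n-2)\Delta_{n+2}=(n-2)(n+1)(n^2+3n-2)\Delta_{n+1}-n^2(2n^3+n^2-7n-4)\Delta_n+(n-1)^2n^4\Delta_{n-1}.$$ Finally, $\Delta_n>0$ for every $n\ge4$, and $\Delta_{2n}$ is even for every $n\ge1$. -/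

import Mathlib

namespace EulerCF

open Finset

/-- `q n = ∑ₖ (n choose k)² k!`. -/
def q (n : ℕ) : ℕ := ∑ k ∈ range (n + 1), n.choose k ^ 2 * k.factorial

/-- `p n = ∑ₖ (n choose k)² k! (2 H_{n-k} - H_k)`, with `H` the harmonic numbers. -/
def p (n : ℕ) : ℚ :=
  ∑ k ∈ range (n + 1),
    (n.choose k : ℚ) ^ 2 * (k.factorial : ℚ) * (2 * harmonic (n - k) - harmonic k)

/-- `Δ n = n (p_{n-1} q_n - p_n q_{n-1})`, for `n ≥ 1` (the value at `0` is `0`). -/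
def Delta (n : ℕ) : ℚ :=
  (n : ℚ) * (p (n - 1) * (q n : ℚ) - p n * (q (n - 1) : ℚ))

/-- The third-order recurrence, for `n ≥ 3`, together with the initial values. Only the
terms of index at least `1` are involved. -/
structure IsGenerated (D : ℕ → ℚ) : Prop where
  init_one : D 1 = -1
  init_two : D 2 = -2
  init_three : D 3 = -5
  init_four : D 4 = 8
  recurrence : ∀ n : ℕ, 3 ≤ n →
    ((n : ℚ) - 1) * ((n : ℚ) - 2) * D (n + 2) =
      ((n : ℚ) - 2) * ((n : ℚ) + 1) * ((n : ℚ) ^ 2 + 3 * (n : ℚ) - 2) * D (n + 1)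
      - (n : ℚ) ^ 2 * (2 * (n : ℚ) ^ 3 + (n : ℚ) ^ 2 - 7 * (n : ℚ) - 4) * D n
      + ((n : ℚ) - 1) ^ 2 * (n : ℚ) ^ 4 * D (n - 1)

/-- The partial numerators `a*_n`, `n ≥ 1` (the value at `0` is not used). -/
def aStar : ℕ → ℚ
  | 0 => 0
  | 1 => 1
  | 2 => -1
  | 3 => -5
  | 4 => 36
  | 5 => -15740
  | n => -(((n : ℚ) - 1) ^ 2 / 4) * Delta n * Delta (n - 2)

/-- The partial denominators `b*_n`, `n ≥ 1` (the value at `0` is not used). -/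
def bStar : ℕ → ℚ
  | 0 => 0
  | 1 => 2
  | 2 => 4
  | 3 => 16
  | 4 => 59
  | 5 => 404
  | n => (n : ℚ) ^ 2 * Delta (n - 1) + (((n : ℚ) - 1) * ((n : ℚ) - 2) / 2) * (q (n - 2) : ℚ)

/-- The infinite continued fraction `K_{n ≥ 1} (a n / b n)`, with zero head term. Mathlib
indexes the partial quotients from `0`, hence the shift. -/
def contFrac (a b : ℕ → ℝ) : GenContFract ℝ where
  h := 0
  s := Stream'.Seq.ofStream (fun i : ℕ => (⟨a (i + 1), b (i + 1)⟩ : GenContFract.Pair ℝ))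

/-- The continued fraction `K_{n ≥ 1} (a*_n / b*_n)`. -/
noncomputable def eulerContFrac : GenContFract ℝ :=
  contFrac (fun n => (aStar n : ℝ)) (fun n => (bStar n : ℝ))

end EulerCF

namespace EulerCF

open Finset

/-! Both `q` and `p` satisfy a second-order recurrence, that of `p` with the extra term `-n/(n+2)`
(`q_succ_succ`, `p_succ_succ`). Hence their Casoratian `Delta` obeys a first-order recurrence with
source `q` (`Delta_succ`), which gives integrality, parity, positivity and, after eliminating `q`,
the third-order recurrence. Any two sequences solve the homogeneous recurrence whose coefficients
are their 2×2 minors. Rescaled to have leading coefficient 1, it is the recurrence of the continued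
fraction, so the convergents are `p n / q n` (`exists_eulerContFrac_eq`). For the limit, `p n / q n
- γ` is the average of `2(H_m - γ) - (H_{n-m} - γ) ≈ log (m²/(n-m))` under weights proportional to
`n.choose m / m!`. These concentrate at `m ≈ √n`, where the logarithm is small; a Chebyshev estimate
makes this precise (`abs_p_div_q_sub_le`). -/

/-! ### Recurrences for `q` and `p`. -/

/-- The weight `n!² / (m!² k!)` with `n = m + k`. -/
def weight (m k : ℕ) : ℚ := ((m + k).factorial : ℚ) ^ 2 / ((m.factorial : ℚ) ^ 2 * k.factorial)

/-- The `m`-th term of `p n`, with `n = m + k`. -/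
def pTerm (m k : ℕ) : ℚ := weight m k * (2 * harmonic m - harmonic k)

theorem choose_sq_mul_factorial (m k : ℕ) :
    ((m + k).choose k : ℚ) ^ 2 * (k.factorial : ℚ) = weight m k := by
  have h := Nat.add_choose_mul_factorial_mul_factorial m k
  have hm : (m.factorial : ℚ) ≠ 0 := by positivity
  have hk : (k.factorial : ℚ) ≠ 0 := by positivity
  rw [weight, ← h]
  push_cast
  field_simp

theorem sum_choose_sq_mul_factorial (g : ℕ → ℕ → ℚ) (n : ℕ) :
    ∑ k ∈ range (n + 1), (n.choose k : ℚ) ^ 2 * (k.factorial : ℚ) * g (n - k) k =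
      ∑ m ∈ range (n + 1), weight m (n - m) * g m (n - m) := by
  rw [← sum_range_reflect]
  refine sum_congr rfl fun m hm => ?_
  obtain ⟨k, rfl⟩ := Nat.exists_eq_add_of_le (Nat.lt_succ_iff.mp (mem_range.mp hm))
  have h1 : m + k + 1 - 1 - m = k := by omega
  have h2 : m + k - k = m := by omega
  have h3 : m + k - m = k := by omega
  rw [h1, h2, h3, choose_sq_mul_factorial]

theorem q_eq_sum_weight (n : ℕ) : (q n : ℚ) = ∑ m ∈ range (n + 1), weight m (n - m) := by
  have h := sum_choose_sq_mul_factorial (fun _ _ => 1) n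
  simp only [mul_one] at h
  rw [← h, q]
  push_cast
  rfl

theorem p_eq_sum_pTerm (n : ℕ) : p n = ∑ m ∈ range (n + 1), pTerm m (n - m) :=
  sum_choose_sq_mul_factorial (fun m k => 2 * harmonic m - harmonic k) n

/-- Summing the local relation over a diagonal: the term `f m (k + 2)` lies on the diagonal `n + 1`,
so it raises the coefficient `2n + 3` to `2n + 4`. The last bracket collects the end terms with `k ≤
1`, which the local relation does not reach; it vanishes for `weight` and is `-n/(n+2)` for `pTerm`.
-/
theorem sum_range_eq_of_pascal {f : ℕ → ℕ → ℚ}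
    (h0 : ∀ k : ℕ, f 0 (k + 2) = (2 * k + 3) * f 0 (k + 1) - ((k : ℚ) + 1) ^ 2 * f 0 k)
    (h1 : ∀ m k : ℕ, f (m + 1) (k + 2) = (2 * (m + 1 + k) + 3) * f (m + 1) (k + 1) + f m (k + 2)
      - ((m : ℚ) + 1 + k + 1) ^ 2 * f (m + 1) k) (n : ℕ) :
    ∑ m ∈ range (n + 3), f m (n + 2 - m) =
      (2 * n + 4) * ∑ m ∈ range (n + 2), f m (n + 1 - m)
      - ((n : ℚ) + 1) ^ 2 * ∑ m ∈ range (n + 1), f m (n - m)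
      + (f (n + 1) 1 + f (n + 2) 0 - (2 * n + 4) * f (n + 1) 0 - f n 1) := by
  have key : ∑ m ∈ range (n + 1), f m (n + 2 - m) =
      (2 * n + 3) * ∑ m ∈ range (n + 1), f m (n + 1 - m) + ∑ m ∈ range n, f m (n + 1 - m)
      - ((n : ℚ) + 1) ^ 2 * ∑ m ∈ range (n + 1), f m (n - m) := by
    rw [sum_range_succ', sum_range_succ' (fun m => f m (n + 1 - m)),
      sum_range_succ' (fun m => f m (n - m))]
    have : ∀ m ∈ range n, f (m + 1) (n + 2 - (m + 1)) =
        (2 * n + 3) * f (m + 1) (n + 1 - (m + 1)) + f m (n + 1 - m)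
          - ((n : ℚ) + 1) ^ 2 * f (m + 1) (n - (m + 1)) := by
      intro m hm
      obtain ⟨k, rfl⟩ := Nat.exists_eq_add_of_lt (mem_range.mp hm)
      have e1 : m + k + 1 + 2 - (m + 1) = k + 2 := by omega
      have e2 : m + k + 1 + 1 - (m + 1) = k + 1 := by omega
      have e3 : m + k + 1 + 1 - m = k + 2 := by omega
      have e4 : m + k + 1 - (m + 1) = k := by omega
      rw [e1, e2, e3, e4, h1]
      push_cast
      ring
    rw [sum_congr rfl this, sum_sub_distrib, sum_add_distrib, ← mul_sum, ← mul_sum]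
    simp only [Nat.sub_zero, h0]
    ring
  have e1 : n + 2 - (n + 1) = 1 := by omega
  have e2 : n + 1 - n = 1 := by omega
  rw [sum_range_succ, sum_range_succ, key, sum_range_succ (fun m => f m (n + 1 - m)) (n + 1),
    sum_range_succ (fun m => f m (n + 1 - m)) n, e1, e2, Nat.sub_self, Nat.sub_self]
  ring

theorem weight_zero_left (k : ℕ) : weight 0 k = k.factorial := by
  have hk : (k.factorial : ℚ) ≠ 0 := by positivity
  simp only [weight, zero_add, Nat.factorial_zero]
  field_simp
  norm_num

theorem weight_zero_right (m : ℕ) : weight m 0 = 1 := by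
  have hk : (m.factorial : ℚ) ≠ 0 := by positivity
  simp [weight, hk]

theorem weight_one_right (m : ℕ) : weight m 1 = ((m : ℚ) + 1) ^ 2 := by
  have hk : (m.factorial : ℚ) ≠ 0 := by positivity
  simp only [weight, Nat.factorial_succ, Nat.factorial_zero]
  push_cast
  field_simp

theorem weight_succ_right (m k : ℕ) :
    weight m (k + 1) = ((m : ℚ) + k + 1) ^ 2 / ((k : ℚ) + 1) * weight m k := by
  have hm : (m.factorial : ℚ) ≠ 0 := by positivity
  have hk : (k.factorial : ℚ) ≠ 0 := by positivity
  rw [weight, weight, ← add_assoc, Nat.factorial_succ, Nat.factorial_succ]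
  push_cast
  field_simp

theorem weight_succ_left (m k : ℕ) :
    weight m (k + 1) = ((m : ℚ) + 1) ^ 2 / ((k : ℚ) + 1) * weight (m + 1) k := by
  have hm : (m.factorial : ℚ) ≠ 0 := by positivity
  have hk : (k.factorial : ℚ) ≠ 0 := by positivity
  rw [weight, weight, show m + (k + 1) = m + 1 + k by ring, Nat.factorial_succ m,
    Nat.factorial_succ k]
  push_cast
  field_simp

theorem q_succ_succ (n : ℕ) :
    (q (n + 2) : ℚ) = (2 * n + 4) * q (n + 1) - ((n : ℚ) + 1) ^ 2 * q n := by
  rw [q_eq_sum_weight, q_eq_sum_weight, q_eq_sum_weight]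
  rw [sum_range_eq_of_pascal]
  · simp only [weight_zero_right, weight_one_right]
    push_cast
    ring
  · intro k
    simp only [weight_zero_left, Nat.factorial_succ]
    push_cast
    ring
  · intro m k
    rw [weight_succ_left m, weight_succ_right (m + 1) (k + 1), weight_succ_right (m + 1) k]
    push_cast
    field_simp
    ring

theorem p_succ_succ (n : ℕ) :
    p (n + 2) = (2 * n + 4) * p (n + 1) - ((n : ℚ) + 1) ^ 2 * p n - n / (n + 2) := by
  rw [p_eq_sum_pTerm, p_eq_sum_pTerm, p_eq_sum_pTerm]
  rw [sum_range_eq_of_pascal]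
  · simp only [pTerm, weight_zero_right, weight_one_right, harmonic_succ, harmonic_zero]
    push_cast
    field_simp
    ring
  · intro k
    simp only [pTerm, weight_zero_left, Nat.factorial_succ, harmonic_succ, harmonic_zero]
    push_cast
    field_simp
    ring
  · intro m k
    simp only [pTerm]
    rw [weight_succ_left m, weight_succ_right (m + 1) (k + 1), weight_succ_right (m + 1) k]
    simp only [harmonic_succ]
    push_cast
    field_simp
    ring

/-! ### Arithmetic of `Delta`. -/

theorem q_zero : q 0 = 1 := by simp [q]
theorem q_one : q 1 = 2 := by decide
theorem p_zero : p 0 = 0 := by simp [p]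
theorem p_one : p 1 = 1 := by simp [p, sum_range_succ]; norm_num

theorem q_pos (n : ℕ) : 0 < q n :=
  sum_pos (fun k hk => by
    have := Nat.choose_pos (Nat.lt_succ_iff.mp (mem_range.mp hk))
    positivity) ⟨0, by simp⟩

theorem Delta_zero : Delta 0 = 0 := by simp [Delta]

theorem Delta_one : Delta 1 = -1 := by simp [Delta, p_zero, p_one, q_zero]

theorem Delta_succ (n : ℕ) :
    Delta (n + 1) = n * (n + 1) * Delta n + ((n : ℚ) - 1) * q n := by
  rcases n with _ | n
  · simp [Delta_zero, Delta_one, q_zero]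
  · simp only [Delta, Nat.add_sub_cancel]
    rw [p_succ_succ, q_succ_succ]
    push_cast
    field_simp
    ring

theorem exists_int_Delta (n : ℕ) : ∃ z : ℤ, Delta n = (z : ℚ) := by
  induction n with
  | zero => exact ⟨0, by simp [Delta_zero]⟩
  | succ n ih =>
    obtain ⟨z, hz⟩ := ih
    exact ⟨n * (n + 1) * z + (n - 1) * q n, by rw [Delta_succ, hz]; push_cast; ring⟩

theorem exists_int_Delta_even (n : ℕ) (hn : 1 ≤ n) : ∃ z : ℤ, Delta (2 * n) = 2 * (z : ℚ) := by
  obtain ⟨n, rfl⟩ := Nat.exists_eq_add_of_le' hn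
  obtain ⟨z, hz⟩ := exists_int_Delta (2 * n + 1)
  refine ⟨(2 * n + 1) * (n + 1) * z + n * q (2 * n + 1), ?_⟩
  rw [show 2 * (n + 1) = 2 * n + 1 + 1 by ring, Delta_succ, hz]
  push_cast
  ring

theorem q_two : (q 2 : ℚ) = 7 := by rw [q_succ_succ, q_one, q_zero]; norm_num
theorem q_three : (q 3 : ℚ) = 34 := by rw [q_succ_succ, q_two, q_one]; norm_num
theorem q_four : (q 4 : ℚ) = 209 := by rw [q_succ_succ, q_three, q_two]; norm_num
theorem q_five : (q 5 : ℚ) = 1546 := by rw [q_succ_succ, q_four, q_three]; norm_num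
theorem p_two : p 2 = 4 := by rw [p_succ_succ, p_one, p_zero]; norm_num
theorem p_three : p 3 = 59 / 3 := by rw [p_succ_succ, p_two, p_one]; norm_num
theorem p_four : p 4 = 8 * (59 / 3) - 9 * 4 - 1 / 2 := by
  rw [p_succ_succ, p_three, p_two]; norm_num
theorem p_five : p 5 = 10 * (8 * (59 / 3) - 9 * 4 - 1 / 2) - 16 * (59 / 3) - 3 / 5 := by
  rw [p_succ_succ, p_four, p_three]; norm_num
theorem Delta_two : Delta 2 = -2 := by rw [Delta_succ, Delta_one]; norm_num
theorem Delta_three : Delta 3 = -5 := by rw [Delta_succ, Delta_two, q_two]; norm_num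
theorem Delta_four : Delta 4 = 8 := by rw [Delta_succ, Delta_three, q_three]; norm_num

theorem Delta_pos (n : ℕ) (hn : 4 ≤ n) : 0 < Delta n := by
  induction n, hn using Nat.le_induction with
  | base => rw [Delta_four]; norm_num
  | succ n hn ih =>
    rw [Delta_succ]
    have h1 : (0 : ℚ) < q n := by exact_mod_cast q_pos n
    have h2 : (4 : ℚ) ≤ n := by exact_mod_cast hn
    have h3 : (0 : ℚ) < n - 1 := by linarith
    positivity

theorem isGenerated_Delta : IsGenerated Delta where
  init_one := Delta_one
  init_two := Delta_two
  init_three := Delta_three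
  init_four := Delta_four
  recurrence := by
    intro n hn
    obtain ⟨n, rfl⟩ := Nat.exists_eq_add_of_le' (show 1 ≤ n by omega)
    -- Everything reduces to `Delta n`, `q n` and `q (n + 1)`, whose coefficients agree identically.
    rw [Nat.add_sub_cancel, Delta_succ (n + 2), Delta_succ (n + 1), Delta_succ n, q_succ_succ]
    push_cast
    ring

theorem IsGenerated.eq_Delta {D : ℕ → ℚ} (hD : IsGenerated D) (n : ℕ) (hn : 1 ≤ n) :
    D n = Delta n := by
  induction n using Nat.strong_induction_on with
  | _ n ih =>
    rcases Nat.lt_or_ge n 5 with h | h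
    · interval_cases n
      · rw [hD.init_one, Delta_one]
      · rw [hD.init_two, Delta_two]
      · rw [hD.init_three, Delta_three]
      · rw [hD.init_four, Delta_four]
    · obtain ⟨m, rfl⟩ := Nat.exists_eq_add_of_le' (show 2 ≤ n by omega)
      have h1 := hD.recurrence m (by omega)
      have h2 := isGenerated_Delta.recurrence m (by omega)
      rw [ih (m + 1) (by omega) (by omega), ih m (by omega) (by omega),
        ih (m - 1) (by omega) (by omega), ← h2] at h1
      have h3 : (3 : ℚ) ≤ m := by exact_mod_cast (show 3 ≤ m by omega)
      have h4 : ((m : ℚ) - 1) * ((m : ℚ) - 2) ≠ 0 :=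
        mul_ne_zero (by linarith) (by linarith)
      exact mul_left_cancel₀ h4 h1

/-! ### Identification of the convergents. -/

/-- A 3×3 determinant with rows `p`, `p`, `q` at `n`, `n + 1`, `n + 2` vanishes; expand along the
first row and multiply by `(n+1)(n+2)/2`. The middle minor is simplified by the recurrences. -/
theorem Delta_mul_p (n : ℕ) :
    ((n : ℚ) + 2) / 2 * Delta (n + 1) * p (n + 2) =
      (((n : ℚ) + 2) ^ 2 * Delta (n + 1) + ((n : ℚ) + 1) * n / 2 * q n) * p (n + 1)
        - ((n : ℚ) + 1) / 2 * Delta (n + 2) * p n := by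
  simp only [Delta, Nat.add_sub_cancel, show n + 2 - 1 = n + 1 by omega]
  rw [p_succ_succ, q_succ_succ]
  push_cast
  field_simp
  ring

theorem Delta_mul_q (n : ℕ) :
    ((n : ℚ) + 2) / 2 * Delta (n + 1) * q (n + 2) =
      (((n : ℚ) + 2) ^ 2 * Delta (n + 1) + ((n : ℚ) + 1) * n / 2 * q n) * q (n + 1)
        - ((n : ℚ) + 1) / 2 * Delta (n + 2) * q n := by
  simp only [Delta, Nat.add_sub_cancel, show n + 2 - 1 = n + 1 by omega]
  rw [p_succ_succ, q_succ_succ]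
  push_cast
  field_simp
  ring

theorem aStar_add_six (n : ℕ) :
    aStar (n + 6) = -(((n : ℚ) + 5) ^ 2 / 4) * Delta (n + 6) * Delta (n + 4) := by
  have : aStar (n + 6) = -((((n + 6 : ℕ) : ℚ) - 1) ^ 2 / 4) * Delta (n + 6) * Delta (n + 4) := rfl
  rw [this]
  push_cast
  ring

theorem bStar_add_six (n : ℕ) :
    bStar (n + 6) = ((n : ℚ) + 6) ^ 2 * Delta (n + 5)
      + ((n : ℚ) + 5) * ((n : ℚ) + 4) / 2 * q (n + 4) := by
  have : bStar (n + 6) = ((n + 6 : ℕ) : ℚ) ^ 2 * Delta (n + 5)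
      + ((((n + 6 : ℕ) : ℚ) - 1) * (((n + 6 : ℕ) : ℚ) - 2) / 2) * q (n + 4) := rfl
  rw [this]
  push_cast
  ring

theorem aStar_ne_zero (n : ℕ) (hn : 1 ≤ n) : aStar n ≠ 0 := by
  rcases Nat.lt_or_ge n 6 with h | h
  · interval_cases n <;> norm_num [aStar]
  · obtain ⟨n, rfl⟩ := Nat.exists_eq_add_of_le' h
    rw [aStar_add_six]
    have h1 := Delta_pos (n + 6) (by omega)
    have h2 := Delta_pos (n + 4) (by omega)
    have h3 : (0 : ℚ) < (n + 5) ^ 2 / 4 := by positivity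
    exact mul_ne_zero (mul_ne_zero (neg_ne_zero.mpr h3.ne') h1.ne') h2.ne'

theorem eulerContFrac_nums_zero : eulerContFrac.nums 0 = 0 :=
  GenContFract.zeroth_num_eq_h

theorem eulerContFrac_dens_zero : eulerContFrac.dens 0 = 1 :=
  GenContFract.zeroth_den_eq_one

theorem eulerContFrac_nums_one : eulerContFrac.nums 1 = 1 := by
  rw [GenContFract.first_num_eq (gp := ⟨(aStar 1 : ℝ), (bStar 1 : ℝ)⟩) rfl]
  simp [eulerContFrac, contFrac, aStar]

theorem eulerContFrac_dens_one : eulerContFrac.dens 1 = 2 := by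
  rw [GenContFract.first_den_eq (gp := ⟨(aStar 1 : ℝ), (bStar 1 : ℝ)⟩) rfl]
  simp [bStar]

theorem eulerContFrac_nums_succ_succ (n : ℕ) :
    eulerContFrac.nums (n + 2) =
      bStar (n + 2) * eulerContFrac.nums (n + 1) + aStar (n + 2) * eulerContFrac.nums n :=
  GenContFract.nums_recurrence (gp := ⟨(aStar (n + 2) : ℝ), (bStar (n + 2) : ℝ)⟩) rfl rfl rfl

theorem eulerContFrac_dens_succ_succ (n : ℕ) :
    eulerContFrac.dens (n + 2) =
      bStar (n + 2) * eulerContFrac.dens (n + 1) + aStar (n + 2) * eulerContFrac.dens n :=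
  GenContFract.dens_recurrence (gp := ⟨(aStar (n + 2) : ℝ), (bStar (n + 2) : ℝ)⟩) rfl rfl rfl

theorem eulerContFrac_nums_two : eulerContFrac.nums 2 = 4 := by
  rw [eulerContFrac_nums_succ_succ, eulerContFrac_nums_one, eulerContFrac_nums_zero]
  norm_num [aStar, bStar]

theorem eulerContFrac_dens_two : eulerContFrac.dens 2 = 7 := by
  rw [eulerContFrac_dens_succ_succ, eulerContFrac_dens_one, eulerContFrac_dens_zero]
  norm_num [aStar, bStar]

theorem eulerContFrac_nums_three : eulerContFrac.nums 3 = 59 := by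
  rw [eulerContFrac_nums_succ_succ, eulerContFrac_nums_two, eulerContFrac_nums_one]
  norm_num [aStar, bStar]

theorem eulerContFrac_dens_three : eulerContFrac.dens 3 = 102 := by
  rw [eulerContFrac_dens_succ_succ, eulerContFrac_dens_two, eulerContFrac_dens_one]
  norm_num [aStar, bStar]

theorem eulerContFrac_nums_four : eulerContFrac.nums 4 = (30 * p 4 : ℚ) := by
  rw [eulerContFrac_nums_succ_succ, eulerContFrac_nums_three, eulerContFrac_nums_two, p_four]
  norm_num [aStar, bStar]

theorem eulerContFrac_dens_four : eulerContFrac.dens 4 = (30 * q 4 : ℚ) := by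
  rw [eulerContFrac_dens_succ_succ, eulerContFrac_dens_three, eulerContFrac_dens_two, q_four]
  norm_num [aStar, bStar]

/-- The scaling factor grows by `(n+5)/2 * Delta (n+4)` at each step, the leading coefficient in
`Delta_mul_p`. Two consecutive indices are carried because the recurrence has order two; starting at
4 keeps the factor nonzero by `Delta_pos`. -/
theorem exists_eulerContFrac_eq (n : ℕ) : ∃ c : ℚ, c ≠ 0 ∧
    eulerContFrac.nums (n + 4) = (c * p (n + 4) : ℚ) ∧
    eulerContFrac.dens (n + 4) = (c * q (n + 4) : ℚ) ∧
    eulerContFrac.nums (n + 5) = (c * ((n + 5) / 2 * Delta (n + 4)) * p (n + 5) : ℚ) ∧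
    eulerContFrac.dens (n + 5) = (c * ((n + 5) / 2 * Delta (n + 4)) * q (n + 5) : ℚ) := by
  induction n with
  | zero =>
    -- The fourth denominator is `59 * 102 + 36 * 7 = 30 * 209`.
    refine ⟨30, by norm_num, eulerContFrac_nums_four, eulerContFrac_dens_four, ?_, ?_⟩
    · rw [eulerContFrac_nums_succ_succ, eulerContFrac_nums_four, eulerContFrac_nums_three, p_four,
        p_five, Delta_four]
      norm_num [aStar, bStar]
    · rw [eulerContFrac_dens_succ_succ, eulerContFrac_dens_four, eulerContFrac_dens_three, q_four,
        q_five, Delta_four]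
      norm_num [aStar, bStar]
  | succ n ih =>
    obtain ⟨c, hc, hn, hd, hn', hd'⟩ := ih
    have hD := Delta_pos (n + 4) (by omega)
    have h5 : ((n : ℚ) + 5) / 2 * Delta (n + 4) ≠ 0 := by positivity
    refine ⟨c * ((n + 5) / 2 * Delta (n + 4)), mul_ne_zero hc h5, ?_, ?_, ?_, ?_⟩
    · rw [show n + 1 + 4 = n + 5 by ring, hn']
    · rw [show n + 1 + 4 = n + 5 by ring, hd']
    · rw [show n + 1 + 5 = n + 4 + 2 by ring, eulerContFrac_nums_succ_succ, hn, hn',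
        ← Rat.cast_mul, ← Rat.cast_mul, ← Rat.cast_add, aStar_add_six, bStar_add_six]
      congr 1
      have h := Delta_mul_p (n + 4)
      push_cast at h ⊢
      linear_combination (-c * (((n : ℚ) + 5) / 2 * Delta (n + 4))) * h
    · rw [show n + 1 + 5 = n + 4 + 2 by ring, eulerContFrac_dens_succ_succ, hd, hd',
        ← Rat.cast_mul, ← Rat.cast_mul, ← Rat.cast_add, aStar_add_six, bStar_add_six]
      congr 1
      have h := Delta_mul_q (n + 4)
      push_cast at h ⊢
      linear_combination (-c * (((n : ℚ) + 5) / 2 * Delta (n + 4))) * h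

theorem eulerContFrac_dens_ne_zero (n : ℕ) : eulerContFrac.dens n ≠ 0 := by
  rcases Nat.lt_or_ge n 4 with h | h
  · interval_cases n
    · rw [eulerContFrac_dens_zero]; norm_num
    · rw [eulerContFrac_dens_one]; norm_num
    · rw [eulerContFrac_dens_two]; norm_num
    · rw [eulerContFrac_dens_three]; norm_num
  · obtain ⟨n, rfl⟩ := Nat.exists_eq_add_of_le' h
    obtain ⟨c, hc, -, hd, -⟩ := exists_eulerContFrac_eq n
    have hq := (q_pos (n + 4)).ne'
    rw [hd]
    exact_mod_cast mul_ne_zero hc (Nat.cast_ne_zero.mpr hq)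

theorem eulerContFrac_convs_add_four (n : ℕ) :
    eulerContFrac.convs (n + 4) = (p (n + 4) : ℝ) / (q (n + 4) : ℝ) := by
  obtain ⟨c, hc, hn, hd, -⟩ := exists_eulerContFrac_eq n
  have hc' : (c : ℝ) ≠ 0 := by exact_mod_cast hc
  rw [GenContFract.conv_eq_num_div_den, hn, hd]
  push_cast
  exact mul_div_mul_left _ _ hc'

/-! ### Moments of the weights. -/

/-- The weight `(n choose m) / m!`, which is `weight m (n - m)` divided by `n!`. -/
noncomputable def relWeight (n m : ℕ) : ℝ := (n.choose m : ℝ) / m.factorial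

theorem relWeight_nonneg (n m : ℕ) : 0 ≤ relWeight n m := by
  unfold relWeight
  positivity

theorem cast_weight_eq {n m : ℕ} (h : m ≤ n) :
    (weight m (n - m) : ℝ) = n.factorial * relWeight n m := by
  obtain ⟨k, rfl⟩ := Nat.exists_eq_add_of_le h
  have e := Nat.add_choose_mul_factorial_mul_factorial m k
  have hm : (m.factorial : ℝ) ≠ 0 := by positivity
  have hk : (k.factorial : ℝ) ≠ 0 := by positivity
  rw [Nat.add_sub_cancel_left, relWeight, weight, Nat.choose_symm_add, ← e]
  push_cast
  field_simp

theorem cast_q_eq (n : ℕ) :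
    (q n : ℝ) = n.factorial * ∑ m ∈ range (n + 1), relWeight n m := by
  have h : (q n : ℝ) = ((q n : ℚ) : ℝ) := by norm_cast
  rw [h, q_eq_sum_weight, mul_sum]
  push_cast
  exact sum_congr rfl fun m hm => cast_weight_eq (Nat.lt_succ_iff.mp (mem_range.mp hm))

theorem cast_p_eq (n : ℕ) :
    (p n : ℝ) = n.factorial * ∑ m ∈ range (n + 1),
      relWeight n m * (2 * (harmonic m : ℝ) - (harmonic (n - m) : ℝ)) := by
  rw [p_eq_sum_pTerm, mul_sum]
  push_cast
  refine sum_congr rfl fun m hm => ?_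
  rw [pTerm, ← mul_assoc, ← cast_weight_eq (Nat.lt_succ_iff.mp (mem_range.mp hm))]
  push_cast
  ring

theorem sum_relWeight_pos (n : ℕ) : 0 < ∑ m ∈ range (n + 1), relWeight n m := by
  have h : (0 : ℝ) < q n := by exact_mod_cast q_pos n
  rw [cast_q_eq] at h
  exact pos_of_mul_pos_right h (by positivity)

theorem relWeight_succ (n m : ℕ) (h : m ≤ n) :
    relWeight n (m + 1) * ((m : ℝ) + 1) ^ 2 = relWeight n m * (n - m) := by
  have e : (n.choose (m + 1) : ℝ) * (m + 1) = n.choose m * (n - m) := by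
    rw [← Nat.cast_sub h]
    exact_mod_cast Nat.choose_succ_right_eq n m
  have hm : (m.factorial : ℝ) ≠ 0 := by positivity
  rw [relWeight, relWeight, Nat.factorial_succ]
  push_cast
  field_simp
  linear_combination e

/-- Shift of index by the ratio of consecutive weights; the term `m = 0` on the left and `m = n` on
the right vanish. All moment bounds come from this identity. -/
theorem sum_relWeight_mul_sq (n : ℕ) (f : ℕ → ℝ) :
    ∑ m ∈ range (n + 1), relWeight n m * ((m : ℝ) ^ 2 * f m) =
      ∑ m ∈ range (n + 1), relWeight n m * ((n - m) * f (m + 1)) := by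
  rw [sum_range_succ', sum_range_succ _ n]
  simp only [Nat.cast_zero, sub_self, zero_mul, mul_zero, add_zero, ne_eq, OfNat.ofNat_ne_zero,
    not_false_eq_true, zero_pow]
  refine sum_congr rfl fun m hm => ?_
  rw [← mul_assoc, ← mul_assoc, ← relWeight_succ n m (mem_range.mp hm).le]
  push_cast
  ring

theorem sum_relWeight_mul_pronic (n : ℕ) :
    ∑ m ∈ range (n + 1), relWeight n m * ((m : ℝ) * (m + 1)) =
      n * ∑ m ∈ range (n + 1), relWeight n m := by
  have h := sum_relWeight_mul_sq n (fun _ => 1)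
  rw [mul_sum, ← sub_eq_zero, ← sum_sub_distrib]
  rw [← sub_eq_zero, ← sum_sub_distrib] at h
  rw [← h]
  exact sum_congr rfl fun m _ => by ring

theorem sum_relWeight_mul_self_le (n : ℕ) :
    ∑ m ∈ range (n + 1), relWeight n m * (m : ℝ) ≤
      √n * ∑ m ∈ range (n + 1), relWeight n m := by
  rcases n.eq_zero_or_pos with rfl | hn
  · simp
  have hn' : (0 : ℝ) < n := by exact_mod_cast hn
  have hs : 0 < √(n : ℝ) := Real.sqrt_pos.mpr hn'
  have hs2 : √(n : ℝ) ^ 2 = n := Real.sq_sqrt hn'.le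
  set s := √(n : ℝ)
  have h : ∑ m ∈ range (n + 1), relWeight n m * (2 * s * m) ≤
      ∑ m ∈ range (n + 1), (relWeight n m * ((m : ℝ) * (m + 1)) + n * relWeight n m) := by
    refine sum_le_sum fun m _ => ?_
    -- AM-GM, compared with `m(m+1)` because its mean is exactly `n`.
    have : 2 * s * m ≤ (m : ℝ) * (m + 1) + n := by
      have := sq_nonneg ((m : ℝ) - s)
      have hm : (0 : ℝ) ≤ m := m.cast_nonneg
      nlinarith
    have := mul_le_mul_of_nonneg_left this (relWeight_nonneg n m)
    linarith
  rw [sum_add_distrib, ← mul_sum, sum_relWeight_mul_pronic, ← hs2] at h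
  have e : ∑ m ∈ range (n + 1), relWeight n m * (2 * s * m) =
      2 * s * ∑ m ∈ range (n + 1), relWeight n m * (m : ℝ) := by
    rw [mul_sum]
    exact sum_congr rfl fun m _ => by ring
  rw [e] at h
  refine le_of_mul_le_mul_left (h.trans (le_of_eq ?_)) (show 0 < 2 * s by positivity)
  ring

/-- The shift turns `m²(m+1)²` into `(n-m)(m+2)²`. Dropping `-m(m+2)²` and writing `(m+2)² = m(m+1)
+ 3m + 4`, the `n²` terms cancel. -/
theorem sum_relWeight_mul_pronic_sub_sq_le (n : ℕ) :
    ∑ m ∈ range (n + 1), relWeight n m * ((m : ℝ) * (m + 1) - n) ^ 2 ≤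
      (3 * n * √n + 4 * n) * ∑ m ∈ range (n + 1), relWeight n m := by
  have h1 := sum_relWeight_mul_sq n (fun m => ((m : ℝ) + 1) ^ 2)
  have h2 := sum_relWeight_mul_pronic n
  have h3 := mul_le_mul_of_nonneg_left (sum_relWeight_mul_self_le n)
    (show (0 : ℝ) ≤ 3 * n by positivity)
  have e : ∑ m ∈ range (n + 1), relWeight n m * ((m : ℝ) * (m + 1) - n) ^ 2 =
      ∑ m ∈ range (n + 1), relWeight n m * ((m : ℝ) ^ 2 * ((m : ℝ) + 1) ^ 2)
        - 2 * n * ∑ m ∈ range (n + 1), relWeight n m * ((m : ℝ) * (m + 1))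
        + n ^ 2 * ∑ m ∈ range (n + 1), relWeight n m := by
    rw [mul_sum, mul_sum, ← sum_sub_distrib, ← sum_add_distrib]
    exact sum_congr rfl fun m _ => by ring
  have h4 : ∑ m ∈ range (n + 1), relWeight n m * (((n : ℝ) - m) * (((m + 1 : ℕ) : ℝ) + 1) ^ 2) ≤
      n * ∑ m ∈ range (n + 1), relWeight n m * ((m : ℝ) * (m + 1))
        + 3 * n * ∑ m ∈ range (n + 1), relWeight n m * (m : ℝ)
        + 4 * n * ∑ m ∈ range (n + 1), relWeight n m := by
    rw [mul_sum, mul_sum, mul_sum, ← sum_add_distrib, ← sum_add_distrib]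
    refine sum_le_sum fun m _ => ?_
    have : 0 ≤ relWeight n m * (m * ((m : ℝ) + 2) ^ 2) :=
      mul_nonneg (relWeight_nonneg n m) (by positivity)
    push_cast
    linarith
  rw [e, h1, h2]
  rw [h2] at h4
  linarith

/-! ### Harmonic estimates and the limit. -/

open Real in
theorem log_le_harmonic_sub {m : ℕ} (hm : 1 ≤ m) :
    log m ≤ harmonic m - eulerMascheroniConstant := by
  have h := eulerMascheroniConstant_lt_eulerMascheroniSeq' m
  rw [eulerMascheroniSeq', if_neg (by omega)] at h
  linarith

open Real in
theorem harmonic_sub_le_log (m : ℕ) :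
    harmonic m - eulerMascheroniConstant ≤ log (m + 1) := by
  have h := eulerMascheroniSeq_lt_eulerMascheroniConstant m
  rw [eulerMascheroniSeq] at h
  linarith

open Real in
theorem abs_harmonic_sub_le {m n : ℕ} (h : m ≤ n) :
    |(harmonic m : ℝ) - eulerMascheroniConstant| ≤ 1 + log n := by
  have h1 := harmonic_le_one_add_log m
  have h2 := one_half_lt_eulerMascheroniConstant
  have h3 := eulerMascheroniConstant_lt_two_thirds
  have h4 : (0 : ℝ) ≤ log n := log_natCast_nonneg n
  have h5 : log m ≤ log n := by
    rcases Nat.eq_zero_or_pos m with rfl | hm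
    · simpa using h4
    · exact log_le_log (by exact_mod_cast hm) (by exact_mod_cast h)
  have h6 : (0 : ℝ) ≤ harmonic m := by
    rcases Nat.eq_zero_or_pos m with rfl | hm
    · simp
    · exact_mod_cast (harmonic_pos hm.ne').le
  rw [abs_le]
  constructor <;> linarith

open Real in
theorem abs_two_mul_harmonic_sub_le_of_near {m k : ℕ} {δ s : ℝ} (hδ : 0 < δ) (hδ' : δ ≤ 1 / 4)
    (hs : s ^ 2 = m + k) (hδs : 3 ≤ δ * s)
    (h : |(m : ℝ) * (m + 1) - (m + k)| ≤ δ * (m + k)) :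
    |2 * ((harmonic m : ℝ) - eulerMascheroniConstant)
      - (harmonic k - eulerMascheroniConstant)| ≤ 6 * δ := by
  have hs0 : 0 < s := pos_of_mul_pos_right (by linarith) hδ.le
  have hs1 : 12 ≤ s := by nlinarith
  obtain ⟨hl, hu⟩ := abs_le.mp h
  have hn : (144 : ℝ) ≤ m + k := by nlinarith
  set n : ℝ := m + k with hndef
  have hm0 : (0 : ℝ) ≤ m := m.cast_nonneg
  have hk0 : (0 : ℝ) ≤ k := k.cast_nonneg
  have hm2 : (m : ℝ) ≤ 2 * s := by
    refine abs_le_of_sq_le_sq' ?_ (by positivity) |>.2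
    nlinarith
  -- `m + 1 ≤ 3s ≤ δs²`: this is what `3 ≤ δ * s` is for.
  have hmn : (m : ℝ) + 1 ≤ δ * n := by nlinarith
  have hδn : δ * n ≤ n / 4 := by nlinarith
  have hm1 : 1 ≤ m := by
    by_contra hcon
    have : m = 0 := by omega
    rw [this] at hl
    norm_num at hl
    linarith
  have hk1 : (0 : ℝ) < k := by linarith
  have hk1' : 1 ≤ k := by exact_mod_cast hk1
  have hmpos : (0 : ℝ) < m := by exact_mod_cast hm1
  have u1 := harmonic_sub_le_log m
  have u2 := log_le_harmonic_sub hk1'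
  have l1 := log_le_harmonic_sub hm1
  have l2 := harmonic_sub_le_log k
  rw [abs_le]
  constructor
  · have e : log (((k : ℝ) + 1) / m ^ 2) = log (k + 1) - 2 * log m := by
      rw [log_div (by positivity) (by positivity), log_pow]
      norm_num
    have h1 := log_le_sub_one_of_pos (show 0 < ((k : ℝ) + 1) / m ^ 2 by positivity)
    have h2 : ((k : ℝ) + 1) / m ^ 2 ≤ 1 + 6 * δ := by
      rw [div_le_iff₀ (by positivity)]
      have h3 : (1 - 2 * δ) * n ≤ m ^ 2 := by nlinarith
      have h4 := mul_le_mul_of_nonneg_left h3 (show 0 ≤ 1 + 6 * δ by positivity)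
      -- The slack in `(1+6δ)(1-2δ) ≥ 1+δ`, nonnegative exactly because `δ ≤ 1/4`.
      have h5 : 0 ≤ (3 * δ - 12 * δ ^ 2) * n := mul_nonneg (by nlinarith) (by linarith)
      nlinarith
    linarith
  · have e : log (((m : ℝ) + 1) ^ 2 / k) = 2 * log (m + 1) - log k := by
      rw [log_div (by positivity) (by positivity), log_pow]
      norm_num
    have h1 := log_le_sub_one_of_pos (show 0 < ((m : ℝ) + 1) ^ 2 / k by positivity)
    have h2 : ((m : ℝ) + 1) ^ 2 / k ≤ 1 + 6 * δ := by
      rw [div_le_iff₀ (by positivity)]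
      have h3 : (1 - δ) * n ≤ k := by linarith
      have h4 := mul_le_mul_of_nonneg_left h3 (show 0 ≤ 1 + 6 * δ by positivity)
      have h5 : 0 ≤ (3 * δ - 6 * δ ^ 2) * n := mul_nonneg (by nlinarith) (by linarith)
      nlinarith
    linarith

-- Chebyshev's device: away from `m(m+1) ≈ n` the crude bound `3(1 + log n)` is multiplied by a
-- ratio that is at least 1. Both nonnegative terms are kept, so that one bound holds for every `m`
-- and can be averaged.
open Real in
theorem abs_two_mul_harmonic_sub_le {m n : ℕ} {δ : ℝ} (hmn : m ≤ n) (hδ : 0 < δ)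
    (hδ' : δ ≤ 1 / 4) (hδs : 3 ≤ δ * √n) :
    |2 * ((harmonic m : ℝ) - eulerMascheroniConstant)
      - (harmonic (n - m) - eulerMascheroniConstant)| ≤
      6 * δ + 3 * (1 + log n) / (δ * n) ^ 2 * ((m : ℝ) * (m + 1) - n) ^ 2 := by
  have hn : 1 ≤ n := by
    by_contra hcon
    have : n = 0 := by omega
    rw [this] at hδs
    norm_num at hδs
  have hn' : (0 : ℝ) < n := by exact_mod_cast hn
  have hlog : (0 : ℝ) ≤ log n := log_natCast_nonneg n
  by_cases h : |(m : ℝ) * (m + 1) - n| ≤ δ * n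
  · have h0 : 0 ≤ 3 * (1 + log n) / (δ * n) ^ 2 * ((m : ℝ) * (m + 1) - n) ^ 2 := by positivity
    have hs : √(n : ℝ) ^ 2 = n := sq_sqrt hn'.le
    obtain ⟨k, rfl⟩ := Nat.exists_eq_add_of_le hmn
    rw [Nat.add_sub_cancel_left]
    have := abs_two_mul_harmonic_sub_le_of_near (m := m) (k := k) hδ hδ'
      (by rw [hs]; push_cast; ring) hδs (by push_cast at h; exact h)
    linarith
  · have h1 := abs_harmonic_sub_le hmn
    have h2 := abs_harmonic_sub_le (Nat.sub_le n m)
    have h3 : (δ * n) ^ 2 ≤ ((m : ℝ) * (m + 1) - n) ^ 2 := by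
      rw [← sq_abs ((m : ℝ) * (m + 1) - n)]
      exact pow_le_pow_left₀ (by positivity) (not_le.mp h).le 2
    have h4 : 3 * (1 + log n) ≤
        3 * (1 + log n) / (δ * n) ^ 2 * ((m : ℝ) * (m + 1) - n) ^ 2 := by
      rw [div_mul_eq_mul_div, le_div_iff₀ (by positivity)]
      exact mul_le_mul_of_nonneg_left h3 (by positivity)
    refine (abs_sub _ _).trans ?_
    rw [abs_mul, abs_two]
    linarith

open Real in
theorem abs_p_div_q_sub_le {n : ℕ} {δ : ℝ} (hδ : 0 < δ) (hδ' : δ ≤ 1 / 4) (hδs : 3 ≤ δ * √n) :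
    |(p n : ℝ) / q n - eulerMascheroniConstant| ≤
      6 * δ + 21 / δ ^ 2 * ((1 + log n) / √n) := by
  have hspos : 0 < √(n : ℝ) := pos_of_mul_pos_right (by linarith) hδ.le
  have hs1 : 1 ≤ √(n : ℝ) := by nlinarith
  have hn : (0 : ℝ) < n := sqrt_pos.mp hspos
  have hs : √(n : ℝ) ^ 2 = n := sq_sqrt hn.le
  have hlog : (0 : ℝ) ≤ log n := log_natCast_nonneg n
  have hQ := sum_relWeight_pos n
  have hf : (n.factorial : ℝ) ≠ 0 := by positivity
  have hV := sum_relWeight_mul_pronic_sub_sq_le n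
  set Q := ∑ m ∈ range (n + 1), relWeight n m with hQdef
  set C := 3 * (1 + log n) / (δ * n) ^ 2 with hC
  have hC0 : 0 ≤ C := by positivity
  have e : (p n : ℝ) / q n - eulerMascheroniConstant =
      (∑ m ∈ range (n + 1), relWeight n m * (2 * ((harmonic m : ℝ) - eulerMascheroniConstant)
        - (harmonic (n - m) - eulerMascheroniConstant))) / Q := by
    rw [cast_p_eq, cast_q_eq, mul_div_mul_left _ _ hf, eq_div_iff hQ.ne', sub_mul,
      div_mul_cancel₀ _ hQ.ne', hQdef, mul_sum, ← sum_sub_distrib]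
    exact sum_congr rfl fun m _ => by ring
  have hsum : |∑ m ∈ range (n + 1), relWeight n m *
      (2 * ((harmonic m : ℝ) - eulerMascheroniConstant)
        - (harmonic (n - m) - eulerMascheroniConstant))| ≤
      6 * δ * Q + C * ((3 * n * √n + 4 * n) * Q) := by
    refine (abs_sum_le_sum_abs _ _).trans ?_
    refine le_trans ?_ (add_le_add_right (mul_le_mul_of_nonneg_left hV hC0) (6 * δ * Q))
    rw [hQdef, mul_sum, mul_sum, ← sum_add_distrib]
    refine sum_le_sum fun m hm => ?_
    rw [abs_mul, abs_of_nonneg (relWeight_nonneg n m)]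
    have := mul_le_mul_of_nonneg_left (abs_two_mul_harmonic_sub_le
      (Nat.lt_succ_iff.mp (mem_range.mp hm)) hδ hδ' hδs) (relWeight_nonneg n m)
    refine this.trans (le_of_eq ?_)
    ring
  rw [e, abs_div, abs_of_pos hQ, div_le_iff₀ hQ]
  refine hsum.trans ?_
  rw [add_mul (6 * δ), ← mul_assoc C]
  refine add_le_add_right (mul_le_mul_of_nonneg_right ?_ hQ.le) _
  -- Uses `√n ≥ 1`; with the 3 in `C` this gives the constant 21.
  have h7 : 3 * n * √n + 4 * n ≤ 7 * n * √(n : ℝ) := by nlinarith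
  refine (mul_le_mul_of_nonneg_left h7 hC0).trans (le_of_eq ?_)
  rw [hC]
  set s := √(n : ℝ)
  rw [← hs]
  field_simp
  ring

open Real Filter in
theorem tendsto_one_add_log_div_sqrt :
    Tendsto (fun n : ℕ => (1 + log n) / √(n : ℝ)) atTop (nhds 0) := by
  have h1 : Tendsto (fun x : ℝ => log x / √x) atTop (nhds 0) := by
    have := (isLittleO_log_rpow_atTop (show (0 : ℝ) < 1 / 2 by norm_num)).tendsto_div_nhds_zero
    simpa only [sqrt_eq_rpow] using this
  have h2 : Tendsto (fun x : ℝ => 1 / √x) atTop (nhds 0) :=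
    tendsto_sqrt_atTop.const_div_atTop 1
  have h3 := (h2.add h1).comp tendsto_natCast_atTop_atTop
  rw [add_zero] at h3
  refine h3.congr fun n => ?_
  simp only [Function.comp_apply]
  rw [add_div]

open Real Filter in
theorem tendsto_p_div_q :
    Tendsto (fun n : ℕ => (p n : ℝ) / q n) atTop (nhds eulerMascheroniConstant) := by
  rw [Metric.tendsto_nhds]
  intro ε hε
  obtain ⟨δ, hδ, hδ', hδε⟩ : ∃ δ : ℝ, 0 < δ ∧ δ ≤ 1 / 4 ∧ 12 * δ ≤ ε :=
    ⟨min (1 / 4) (ε / 12), by positivity, min_le_left _ _, by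
      linarith [min_le_right (1 / 4) (ε / 12)]⟩
  have h1 : Tendsto (fun n : ℕ => δ * √(n : ℝ)) atTop atTop :=
    (tendsto_sqrt_atTop.comp tendsto_natCast_atTop_atTop).const_mul_atTop hδ
  have h2 := tendsto_one_add_log_div_sqrt.const_mul (21 / δ ^ 2)
  rw [mul_zero] at h2
  filter_upwards [h1.eventually_ge_atTop 3, h2.eventually_lt_const (half_pos hε)] with n hn hn'
  rw [Real.dist_eq]
  have := abs_p_div_q_sub_le hδ hδ' hn
  linarith

open Filter in
theorem tendsto_eulerContFrac_convs :
    Tendsto (fun n : ℕ => eulerContFrac.convs n) atTop (nhds Real.eulerMascheroniConstant) := by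
  rw [← tendsto_add_atTop_iff_nat 4]
  refine ((tendsto_add_atTop_iff_nat 4).mpr tendsto_p_div_q).congr fun n => ?_
  rw [eulerContFrac_convs_add_four]

end EulerCF

theorem mainTheorem1 :
    -- the continued fraction is well formed: its partial numerators and the denominators of
    -- its convergents do not vanish
    (∀ n : ℕ, 1 ≤ n → EulerCF.aStar n ≠ 0) ∧
    (∀ n : ℕ, EulerCF.eulerContFrac.dens n ≠ 0) ∧
    -- its convergents tend to Euler's constant
    Filter.Tendsto (fun n : ℕ => EulerCF.eulerContFrac.convs n) Filter.atTop
      (nhds Real.eulerMascheroniConstant) ∧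
    (∀ n : ℕ, 0 < EulerCF.q n) ∧
    -- the sequence `Delta` consists of integers
    (∀ n : ℕ, 1 ≤ n → ∃ z : ℤ, EulerCF.Delta n = (z : ℚ)) ∧
    -- it is the sequence generated by the recurrence and the initial values
    EulerCF.IsGenerated EulerCF.Delta ∧
    (∀ D : ℕ → ℚ, EulerCF.IsGenerated D → ∀ n : ℕ, 1 ≤ n → D n = EulerCF.Delta n) ∧
    (∀ n : ℕ, 4 ≤ n → 0 < EulerCF.Delta n) ∧
    (∀ n : ℕ, 1 ≤ n → ∃ z : ℤ, EulerCF.Delta (2 * n) = 2 * (z : ℚ)) :=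
  ⟨EulerCF.aStar_ne_zero, EulerCF.eulerContFrac_dens_ne_zero, EulerCF.tendsto_eulerContFrac_convs,
    EulerCF.q_pos, fun n _ => EulerCF.exists_int_Delta n, EulerCF.isGenerated_Delta,
    fun _ hD => hD.eq_Delta, EulerCF.Delta_pos, EulerCF.exists_int_Delta_even⟩
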